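/- Let $(X,\mathcal X)$ be a (non-empty) measurable space, $V:X\to[1,+\infty)$ a measurable function, and $P$ a Markov kernel on $X$. Let $\mathcal B_V$ be the complex Banach space of all measurable $f:X\to\mathbb C$ with $\|f\|_V:=\sup_{x\in X}|f(x)|/V(x)<\infty$, and let $\mathcal B_0$ be the Banach space of bounded measurable functions $f:X\to\mathbb C$ with the supremum norm. Write $(Pf)(x)=\int_X f(y)\,P(x,dy)$, and assume that $PV/V$ is bounded on $X$, so that $P$ acts as a bounded linear operator on $\mathcal B_V$. Assume moreover: 1. (weak drift condition) there exist an integer $N\ge1$, $d\in(0,+\infty)$ and $\delta\in(0,1)$ such that $P^NV\le\delta^N V+d$ on $X$; 2. for some integer $\ell\ge1$, $P^\ell:\mathcal B_0\to\mathcal B_V$ is a compact operator. Set $$\delta_V(P):=\inf\{\delta\in[0,1):\ \exists N\ge1,\ \exists d\in(0,+\infty),\ P^NV\le\delta^NV+d\}.$$ For a bounded operator $L$ on a complex Banach space $\mathcal B$ with spectral radius $r(L)>0$, and $r_0\in(0,r(L))$, say that $L$ has a spectral decomposition with radius $r_0$ if there are $m\ge1$, $\lambda_1,\dots,\lambda_m\in\mathbb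 C$ and integers $p_1,\dots,p_m\ge1$ such that $$\mathcal B=\bigoplus_{i=1}^m\ker(L-\lambda_iI)^{p_i}\oplus H,$$ with $|\lambda_i|\ge r_0$, $1\le\dim\ker(L-\lambda_iI)^{p_i}<\infty$, and $H$ a closed $L$-invariant subspace with $\sup_{h\in H,\|h\|\le1}\|L^nh\|=O(r_0^n)$. The operator $L$ is quasi-compact if it has a spectral decomposition with some radius $r_0\in(0,r(L))$. Its essential spectral radius is $$r_{ess}(L):=\lim_{n\to\infty}\Big(\inf_{K\text{ compact}}\|L^n-K\|\Big)^{1/n}.$$ Then, on $\mathcal B_V$, $P$ is power-bounded ($\sup_n\|P^n\|<\infty$) and quasi-compact, and $$r_{ess}(P)\le\delta_V(P).$$ The same bound also holds for the infimum of the $r_0\in(0,r(P))$ for which $P$ has a spectral decomposition with radius $r_0$ (the other usual description of the essential spectral radius of a quasi-compact operator). -/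

import Mathlib

open MeasureTheory ProbabilityTheory Filter
open scoped ENNReal NNReal Topology

noncomputable section

/-- A measurable weight function `V : X → [1, +∞)`. -/
structure Weight (X : Type*) [MeasurableSpace X] where
  toFun : X → ℝ
  measurable' : Measurable toFun
  one_le' : ∀ x, 1 ≤ toFun x

namespace Weight

variable {X : Type*} [MeasurableSpace X]

instance : CoeFun (Weight X) (fun _ => X → ℝ) := ⟨Weight.toFun⟩

theorem pos (V : Weight X) (x : X) : 0 < V x := lt_of_lt_of_le one_pos (V.one_le' x)

/-- The constant weight `1`. -/
def const (X : Type*) [MeasurableSpace X] : Weight X where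
  toFun := fun _ => 1
  measurable' := measurable_const
  one_le' := fun _ => le_rfl

end Weight

/-- The complex vector space of the measurable functions `f : X → ℂ` with `|f| ≤ C V` for some
finite constant `C`. -/
def weightedSubmodule {X : Type*} [MeasurableSpace X] (V : Weight X) : Submodule ℂ (X → ℂ) where
  carrier := {f | Measurable f ∧ ∃ C : ℝ, ∀ x, ‖f x‖ ≤ C * V x}
  zero_mem' := ⟨measurable_const, 0, fun x => by simp⟩
  add_mem' := by
    rintro f g ⟨hf, C, hC⟩ ⟨hg, D, hD⟩
    refine ⟨hf.add hg, C + D, fun x => ?_⟩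
    calc ‖(f + g) x‖ ≤ ‖f x‖ + ‖g x‖ := norm_add_le _ _
      _ ≤ (C + D) * V x := by linarith [hC x, hD x]
  smul_mem' := by
    rintro c f ⟨hf, C, hC⟩
    refine ⟨hf.const_smul c, ‖c‖ * C, fun x => ?_⟩
    calc ‖(c • f) x‖ = ‖c‖ * ‖f x‖ := by simp
      _ ≤ ‖c‖ * (C * V x) := mul_le_mul_of_nonneg_left (hC x) (norm_nonneg _)
      _ = ‖c‖ * C * V x := by ring

/-- The weighted-supremum space `B_V`. -/
def BSpace {X : Type*} [MeasurableSpace X] (V : Weight X) : Type _ := weightedSubmodule V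

namespace BSpace

variable {X : Type*} [MeasurableSpace X] {V : Weight X}

instance : AddCommGroup (BSpace V) := inferInstanceAs (AddCommGroup (weightedSubmodule V))

instance : Module ℂ (BSpace V) := inferInstanceAs (Module ℂ (weightedSubmodule V))

instance : CoeFun (BSpace V) (fun _ => X → ℂ) := ⟨fun f => f.1⟩

theorem ext {f g : BSpace V} (h : ∀ x, f x = g x) : f = g := Subtype.ext (funext h)

theorem measurable (f : BSpace V) : Measurable (f : X → ℂ) := f.2.1

theorem zero_apply (x : X) : (0 : BSpace V) x = 0 := rfl

theorem add_apply (f g : BSpace V) (x : X) : (f + g) x = f x + g x := rfl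

theorem neg_apply (f : BSpace V) (x : X) : (-f) x = -f x := rfl

theorem smul_apply (c : ℂ) (f : BSpace V) (x : X) : (c • f) x = c * f x := rfl

/-- `‖f‖_V = sup_x |f x| / V x`. -/
instance : Norm (BSpace V) := ⟨fun f => ⨆ x, ‖f x‖ / V x⟩

theorem norm_def (f : BSpace V) : ‖f‖ = ⨆ x, ‖f x‖ / V x := rfl

theorem bddAbove (f : BSpace V) : BddAbove (Set.range fun x => ‖f x‖ / V x) := by
  obtain ⟨C, hC⟩ := f.2.2
  refine ⟨C, ?_⟩
  rintro _ ⟨x, rfl⟩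
  exact (div_le_iff₀ (V.pos x)).2 (hC x)

theorem norm_apply_le (f : BSpace V) (x : X) : ‖f x‖ ≤ ‖f‖ * V x :=
  (div_le_iff₀ (V.pos x)).1 (le_ciSup f.bddAbove x)

theorem norm_nonneg' (f : BSpace V) : 0 ≤ ‖f‖ :=
  Real.iSup_nonneg fun x => div_nonneg (norm_nonneg _) (V.pos x).le

theorem norm_le_of_forall (f : BSpace V) {C : ℝ} (hC : 0 ≤ C) (h : ∀ x, ‖f x‖ ≤ C * V x) :
    ‖f‖ ≤ C :=
  Real.iSup_le (fun x => (div_le_iff₀ (V.pos x)).2 (h x)) hC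

instance : NormedAddCommGroup (BSpace V) :=
  AddGroupNorm.toNormedAddCommGroup
    { toFun := fun f => ‖f‖
      map_zero' := le_antisymm
        (norm_le_of_forall _ le_rfl fun x => by simp [zero_apply]) (norm_nonneg' _)
      add_le' := fun f g => norm_le_of_forall _ (add_nonneg (norm_nonneg' f) (norm_nonneg' g))
        fun x => by
          rw [add_apply, add_mul]
          exact (norm_add_le _ _).trans (add_le_add (norm_apply_le f x) (norm_apply_le g x))
      neg' := fun f => by simp only [norm_def, neg_apply, norm_neg]
      eq_zero_of_map_eq_zero' := fun f hf => ext fun x => by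
        have h := norm_apply_le f x
        rw [hf, zero_mul] at h
        exact norm_le_zero_iff.1 h }

instance : NormedSpace ℂ (BSpace V) where
  norm_smul_le c f := norm_le_of_forall _ (mul_nonneg (norm_nonneg c) (norm_nonneg' f)) fun x => by
    rw [smul_apply, norm_mul, mul_assoc]
    exact mul_le_mul_of_nonneg_left (norm_apply_le f x) (norm_nonneg c)

end BSpace

/-- The space `B_0` of the bounded measurable functions with the supremum norm, i.e. the weighted
space with weight `1`. -/
abbrev BoundedMeas (X : Type*) [MeasurableSpace X] : Type _ := BSpace (Weight.const X)

section Kernels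

variable {X : Type*} [MeasurableSpace X]

/-- The inclusion `B_0 → B_V`, `f ↦ f`. -/
def BSpace.incl (V : Weight X) : BoundedMeas X →L[ℂ] BSpace V :=
  LinearMap.mkContinuous
    { toFun := fun f => ⟨f.1, f.2.1, ‖f‖, fun x => (BSpace.norm_apply_le f x).trans
        (mul_le_mul_of_nonneg_left (V.one_le' x) (norm_nonneg f))⟩
      map_add' := fun _ _ => rfl
      map_smul' := fun _ _ => rfl } 1
    (fun f => by
      rw [one_mul]
      exact BSpace.norm_le_of_forall _ (norm_nonneg f) fun x =>
        (BSpace.norm_apply_le f x).trans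
          (mul_le_mul_of_nonneg_left (V.one_le' x) (norm_nonneg f)))

/-- The function `x ↦ (P^n V)(x)`, as an iterated integral with values in `[0, +∞]`. -/
def iterWeight (P : Kernel X X) (V : Weight X) (n : ℕ) : X → ℝ≥0∞ :=
  (fun (g : X → ℝ≥0∞) (x : X) => ∫⁻ y, g y ∂(P x))^[n] (fun x => ENNReal.ofReal (V x))

/-- `P V / V` is bounded, so that `P` acts continuously on `B_V`. -/
def ActsOn (P : Kernel X X) (V : Weight X) : Prop :=
  ∃ c : ℝ, ∀ x, ∫⁻ y, ENNReal.ofReal (V y) ∂(P x) ≤ ENNReal.ofReal (c * V x)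

theorem ActsOn.integrable_weight {P : Kernel X X} {V : Weight X} (h : ActsOn P V) (x : X) :
    Integrable (fun y => V y) (P x) := by
  obtain ⟨c, hc⟩ := h
  refine ⟨V.measurable'.aestronglyMeasurable, ?_⟩
  rw [hasFiniteIntegral_iff_ofReal (Eventually.of_forall fun y => (V.pos y).le)]
  exact (hc x).trans_lt ENNReal.ofReal_lt_top

theorem ActsOn.integrable {P : Kernel X X} {V : Weight X} (h : ActsOn P V) (f : BSpace V) (x : X) :
    Integrable (fun y => f y) (P x) :=
  ((h.integrable_weight x).const_mul ‖f‖).mono' f.measurable.aestronglyMeasurable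
    (Eventually.of_forall fun y => BSpace.norm_apply_le f y)

theorem ActsOn.exists_bound {P : Kernel X X} {V : Weight X} (h : ActsOn P V) :
    ∃ c : ℝ, 0 ≤ c ∧ ∀ (f : BSpace V) (x : X), ‖∫ y, f y ∂(P x)‖ ≤ c * ‖f‖ * V x := by
  obtain ⟨c, hc⟩ := id h
  refine ⟨max c 0, le_max_right _ _, fun f x => ?_⟩
  have hV : ∫ y, V y ∂(P x) ≤ max c 0 * V x := by
    rw [integral_eq_lintegral_of_nonneg_ae (Eventually.of_forall fun y => (V.pos y).le)
      V.measurable'.aestronglyMeasurable]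
    refine ENNReal.toReal_le_of_le_ofReal (mul_nonneg (le_max_right _ _) (V.pos x).le)
      ((hc x).trans (ENNReal.ofReal_le_ofReal ?_))
    exact mul_le_mul_of_nonneg_right (le_max_left _ _) (V.pos x).le
  calc ‖∫ y, f y ∂(P x)‖ ≤ ∫ y, ‖f‖ * V y ∂(P x) :=
        norm_integral_le_of_norm_le ((h.integrable_weight x).const_mul ‖f‖)
          (Eventually.of_forall fun y => BSpace.norm_apply_le f y)
    _ = ‖f‖ * ∫ y, V y ∂(P x) := integral_const_mul _ _
    _ ≤ ‖f‖ * (max c 0 * V x) := mul_le_mul_of_nonneg_left hV (norm_nonneg f)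
    _ = max c 0 * ‖f‖ * V x := by ring

/-- The operator `f ↦ P f`, `(P f)(x) = ∫ f(y) P(x, dy)`, on `B_V`. -/
def kernelOp (P : Kernel X X) (V : Weight X) (h : ActsOn P V) : BSpace V →L[ℂ] BSpace V :=
  LinearMap.mkContinuousOfExistsBound
    { toFun := fun f => ⟨fun x => ∫ y, f y ∂(P x),
        (f.measurable.stronglyMeasurable.integral_kernel).measurable,
        h.exists_bound.choose * ‖f‖, fun x => h.exists_bound.choose_spec.2 f x⟩
      map_add' := fun f g => BSpace.ext fun x =>
        integral_add (h.integrable f x) (h.integrable g x)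
      map_smul' := fun c f => BSpace.ext fun x => integral_const_mul c (fun y => f y) }
    (by
      obtain ⟨c, hc0, hc⟩ := h.exists_bound
      exact ⟨c, fun f => BSpace.norm_le_of_forall _ (mul_nonneg hc0 (norm_nonneg f))
        fun x => hc f x⟩)

/-- The inequality `P^N V ≤ δ^N V + d 1_X`. -/
def DriftIneq (P : Kernel X X) (V : Weight X) (N : ℕ) (d δ : ℝ) : Prop :=
  ∀ x, iterWeight P V N x ≤ ENNReal.ofReal (δ ^ N * V x + d)

/-- The weak drift condition. -/
def WeakDrift (P : Kernel X X) (V : Weight X) : Prop :=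
  ∃ N : ℕ, 1 ≤ N ∧ ∃ d : ℝ, 0 < d ∧ ∃ δ : ℝ, 0 < δ ∧ δ < 1 ∧ DriftIneq P V N d δ

/-- The infimum `δ_V(P)` of the admissible `δ ∈ [0, 1)`. -/
def driftRadius (P : Kernel X X) (V : Weight X) : ℝ :=
  sInf {δ : ℝ | 0 ≤ δ ∧ δ < 1 ∧ ∃ N : ℕ, 1 ≤ N ∧ ∃ d : ℝ, 0 < d ∧ DriftIneq P V N d δ}

end Kernels

section Operators

variable {E : Type*} [NormedAddCommGroup E] [NormedSpace ℂ E]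

/-- `sup_n ‖L^n‖ < ∞`. -/
def PowerBounded (L : E →L[ℂ] E) : Prop := ∃ C : ℝ, ∀ n : ℕ, ‖L ^ n‖ ≤ C

/-- The subspace `ker (L - z I)^p`. -/
def genKer (L : E →L[ℂ] E) (z : ℂ) (p : ℕ) : Submodule ℂ E :=
  LinearMap.ker (((L - z • ContinuousLinearMap.id ℂ E) ^ p : E →L[ℂ] E) : E →ₗ[ℂ] E)

/-- A decomposition `E = ker (L - λ₁ I)^p₁ ⊕ ⋯ ⊕ ker (L - λₘ I)^pₘ ⊕ H` (direct sum, `m ≥ 1`), where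
`|λᵢ| ≥ r₀`, the kernels are nonzero and finite-dimensional, and `H` is a closed `L`-invariant
subspace with `sup {‖L^n h‖ : h ∈ H, ‖h‖ ≤ 1} = O(r₀^n)`. -/
def HasSpectralDecomp (L : E →L[ℂ] E) (r₀ : ℝ) : Prop :=
  ∃ (m : ℕ) (z : Fin m → ℂ) (p : Fin m → ℕ) (H : Submodule ℂ E),
    1 ≤ m ∧
    (∀ i, 1 ≤ p i) ∧
    iSupIndep (fun i => genKer L (z i) (p i)) ∧
    IsCompl (⨆ i, genKer L (z i) (p i)) H ∧
    (∀ i, r₀ ≤ ‖z i‖) ∧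
    (∀ i, genKer L (z i) (p i) ≠ ⊥) ∧
    (∀ i, FiniteDimensional ℂ (genKer L (z i) (p i))) ∧
    IsClosed (H : Set E) ∧
    (∀ h ∈ H, L h ∈ H) ∧
    ∃ C : ℝ, ∀ n : ℕ, ∀ h ∈ H, ‖h‖ ≤ 1 → ‖(L ^ n) h‖ ≤ C * r₀ ^ n

/-- The radii `0 < r₀ < r(L)`, with `r(L)` the spectral radius, for which `L` has a spectral
decomposition. If `r(L) = 1` these are the admissible `r₀ ∈ (0, 1)`; the general case is the one
obtained by applying that case to `r(L)⁻¹ L`. -/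
def decompRadii (L : E →L[ℂ] E) : Set ℝ :=
  {r₀ | 0 < r₀ ∧ ENNReal.ofReal r₀ < spectralRadius ℂ L ∧ HasSpectralDecomp L r₀}

/-- Quasi-compactness of a bounded operator. -/
def IsQuasiCompact (L : E →L[ℂ] E) : Prop := (decompRadii L).Nonempty

/-- The essential spectral radius `lim_n (inf_K ‖L^n - K‖)^(1/n)`, `K` ranging over the compact
operators. The sequence is bounded, and its limit exists because `n ↦ inf_K ‖L^n - K‖` is
submultiplicative, so the limit is the upper limit. -/
def essSpectralRadius (L : E →L[ℂ] E) : ℝ :=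
  limsup (fun n : ℕ => (⨅ K : {K : E →L[ℂ] E // IsCompactOperator K}, ‖L ^ n - K.1‖) ^
    (1 / (n : ℝ))) atTop

end Operators

end

/-!
Fix `L`, the operator `f ↦ P f` on `B_V`, and write `T = L ^ N` with `P^N V ≤ δ^N V + d`.
Multiplying `T f` by the two weights `δ^N V / (δ^N V + d)` and `d / (δ^N V + d)` splits `T` as
`A + D`, where `‖A‖ ≤ δ^N` and `D` maps `B_V` boundedly into `B_0`
(`exists_norm_sub_incl_comp_le`). Since `T` maps `B_0` into itself contractively, iteration gives
`T ^ k = A ^ k + G_k` with `G_k : B_V → B_0` bounded uniformly in `k`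
(`DriftIneq.exists_pow_eq_add`). Two consequences are immediate: `L` is power-bounded, and, because
`L ^ ℓ` is compact from `B_0` to `B_V`, the operator `L ^ (ℓ + N k)` is at distance `O(δ ^ (N k))`
from the compact operator `L ^ ℓ G_k` (`DriftIneq.isNearCompact`). The latter bounds the essential
spectral radius by `δ`.

The spectral decomposition for a radius `r` with `δ < r < 1` is a statement on bounded operators `L`
of a Banach space whose powers `L ^ n` are `O(δ ^ n)`-close to compact operators
(`IsNearCompact.hasSpectralDecomp`). A Riesz-lemma argument shows that the process of adjoining to a
finite-dimensional invariant subspace `F` an eigenvector modulo `F`, for an eigenvalue of modulus at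
least `r`, stops after finitely many steps (`false_of_infinite_flag`). When it stops, the operator
induced by `L` on the quotient by `F`, realized as `J L` where `1 - J` is a bounded projection onto
`F`, has no eigenvalue in `|z| ≥ r`, and by the Fredholm alternative no spectrum there
(`exists_eigenvector_of_mem_spectrum`). If `q` is the minimal polynomial of `L` on `F`, then
`q(J L)` is invertible and `q(L) q(J L)⁻¹ J` is a projection with kernel `F` that commutes with `L`
(`IsComplProj.exists_commute`). Its range is the complement `H`, on which the growth of `L ^ n` is
governed by the spectral radius of `J L`, which is less than `r`; and `F` is the sum of the
generalized eigenspaces. Finally `1` is an eigenvalue of `L` on `B_V`, so every such `r` lies below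
the spectral radius.
-/

/-! ### Spectral values outside the essential disc are eigenvalues -/

section SpectralDecomposition

open Polynomial

variable {E : Type*} [NormedAddCommGroup E] [NormedSpace ℂ E]

theorem exists_eigenvector_of_aeval_prod_apply_eq_zero (M : E →L[ℂ] E) (s : Multiset ℂ) {x : E}
    (hx : x ≠ 0) (h : aeval M (s.map fun a => X - C a).prod x = 0) :
    ∃ a ∈ s, ∃ y, y ≠ 0 ∧ M y = a • y := by
  induction s using Multiset.induction_on with
  | empty => simp [hx] at h
  | cons a s ih =>
    by_cases hy : aeval M (s.map fun a => X - C a).prod x = 0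
    · obtain ⟨b, hb, y, hy0, hy⟩ := ih hy
      exact ⟨b, Multiset.mem_cons_of_mem hb, y, hy0, hy⟩
    · refine ⟨a, Multiset.mem_cons_self a s, _, hy, ?_⟩
      rw [Multiset.map_cons, Multiset.prod_cons, map_mul, mul_apply_eq_comp, map_sub,
        aeval_X, aeval_C, sub_apply, sub_eq_zero] at h
      rw [h, Algebra.algebraMap_eq_smul_one, smul_apply,
        one_apply_eq_self]

theorem exists_eigenvector_of_pow_apply_eq (M : E →L[ℂ] E) {n : ℕ} (hn : n ≠ 0) {μ : ℂ} {x : E}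
    (hx : x ≠ 0) (h : (M ^ n) x = μ ^ n • x) :
    ∃ ν : ℂ, ‖ν‖ = ‖μ‖ ∧ ∃ y, y ≠ 0 ∧ M y = ν • y := by
  have hmonic : (X ^ n - C (μ ^ n) : ℂ[X]).Monic := monic_X_pow_sub_C _ hn
  have hprod : (X ^ n - C (μ ^ n) : ℂ[X]) =
      ((X ^ n - C (μ ^ n) : ℂ[X]).roots.map fun a => X - C a).prod :=
    (IsAlgClosed.splits (X ^ n - C (μ ^ n) : ℂ[X])).eq_prod_roots_of_monic hmonic
  obtain ⟨ν, hν, y, hy0, hy⟩ := exists_eigenvector_of_aeval_prod_apply_eq_zero M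
    (X ^ n - C (μ ^ n) : ℂ[X]).roots hx (by
      rw [← hprod, map_sub, map_pow, aeval_X, aeval_C, sub_apply, h,
        Algebra.algebraMap_eq_smul_one, smul_apply,
        one_apply_eq_self, sub_self])
  refine ⟨ν, ?_, y, hy0, hy⟩
  have hroot : ν ^ n = μ ^ n := by
    have := isRoot_of_mem_roots hν
    simpa [sub_eq_zero] using this
  have := congrArg norm hroot
  rw [norm_pow, norm_pow] at this
  exact (pow_left_inj₀ (norm_nonneg _) (norm_nonneg _) hn).1 this

/-- A spectral value `μ` of `M` gives an eigenvalue of the same modulus as soon as some power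
`M ^ n` is closer than `|μ| ^ n` to a compact operator: the Fredholm alternative makes `μ ^ n` an
eigenvalue of `M ^ n`, and `X ^ n - μ ^ n` splits. -/
theorem exists_eigenvector_of_mem_spectrum [CompleteSpace E] (M K : E →L[ℂ] E)
    (hK : IsCompactOperator K) {n : ℕ} (hn : n ≠ 0) {μ : ℂ} (hμ : μ ∈ spectrum ℂ M)
    (hlt : ‖M ^ n - K‖ < ‖μ‖ ^ n) :
    ∃ ν : ℂ, ‖ν‖ = ‖μ‖ ∧ ∃ y, y ≠ 0 ∧ M y = ν • y := by
  have hE : Nontrivial E := by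
    by_contra hE
    rw [not_nontrivial_iff_subsingleton] at hE
    have : Subsingleton (E →L[ℂ] E) := ⟨fun f g => by ext x; exact Subsingleton.elim _ _⟩
    simp [spectrum.of_subsingleton] at hμ
  have hμn : μ ^ n ∈ spectrum ℂ (M ^ n) := spectrum.pow_mem_pow M n hμ
  -- `μ ^ n - (M ^ n - K)` is invertible because `‖M ^ n - K‖ < |μ ^ n|`.
  have hU : IsUnit (algebraMap ℂ (E →L[ℂ] E) (μ ^ n) - (M ^ n - K)) := by
    by_contra hU
    have := spectrum.norm_le_norm_of_mem (𝕜 := ℂ) (a := M ^ n - K) (k := μ ^ n) hU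
    rw [norm_pow] at this
    exact absurd this (not_le.2 hlt)
  obtain ⟨U, hU⟩ := hU
  have hcomp : IsCompactOperator ((↑U⁻¹ : E →L[ℂ] E) * K : E →L[ℂ] E) :=
    hK.clm_comp (↑U⁻¹ : E →L[ℂ] E)
  rcases hcomp.hasEigenvalue_or_mem_resolventSet one_ne_zero with h | h
  · obtain ⟨x, hx⟩ := h.exists_hasEigenvector
    have h1 : ((↑U⁻¹ : E →L[ℂ] E) * K) x = x := by
      have := hx.apply_eq_smul
      rwa [one_smul] at this
    have h2 : K x = (U : E →L[ℂ] E) x := by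
      conv_rhs => rw [← h1]
      rw [← mul_apply_eq_comp, ← mul_assoc, Units.mul_inv, one_mul]
    refine exists_eigenvector_of_pow_apply_eq M hn hx.2 ?_
    rw [hU, Algebra.algebraMap_eq_smul_one] at h2
    simp only [sub_apply, smul_apply,
      one_apply_eq_self] at h2
    have h3 : μ ^ n • x - (M ^ n) x = 0 := by
      rw [← sub_eq_zero.2 h2.symm]; abel
    exact (sub_eq_zero.1 h3).symm
  · refine absurd ?_ hμn
    rw [spectrum.mem_resolventSet_iff, map_one] at h
    rw [spectrum.mem_resolventSet_iff]
    have : algebraMap ℂ (E →L[ℂ] E) (μ ^ n) - M ^ n = U * (1 - (↑U⁻¹ : E →L[ℂ] E) * K) := by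
      rw [mul_sub, mul_one, ← mul_assoc, Units.mul_inv, one_mul, hU]
      abel
    rw [this]
    exact U.isUnit.mul h

/-! ### Flags of invariant subspaces -/

theorem pow_apply_mem_of_invariant {L : E →L[ℂ] E} {F : Submodule ℂ E} (hF : ∀ x ∈ F, L x ∈ F)
    (n : ℕ) {x : E} (hx : x ∈ F) : (L ^ n) x ∈ F := by
  induction n with
  | zero => simpa
  | succ n ih => rw [pow_succ', mul_apply_eq_comp]; exact hF _ ih

theorem pow_apply_sub_mem_of_invariant {L : E →L[ℂ] E} {F : Submodule ℂ E}
    (hF : ∀ x ∈ F, L x ∈ F) {μ : ℂ} {x : E} (hx : L x - μ • x ∈ F) (n : ℕ) :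
    (L ^ n) x - μ ^ n • x ∈ F := by
  induction n with
  | zero => simp
  | succ n ih =>
    have h : (L ^ (n + 1)) x - μ ^ (n + 1) • x =
        L ((L ^ n) x - μ ^ n • x) + μ ^ n • (L x - μ • x) := by
      rw [pow_succ', mul_apply_eq_comp, map_sub, map_smul, smul_sub, smul_smul,
        pow_succ]
      abel
    rw [h]
    exact F.add_mem (hF _ ih) (F.smul_mem _ hx)

/-- A form of Riesz's lemma: if `x` is an eigenvector of `L` modulo the closed invariant subspace
`F`, then so is some bounded vector of `F + ℂ x` at distance at least `1` from `F`. -/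
theorem exists_riesz_vector {L : E →L[ℂ] E} {F : Submodule ℂ E} (hcl : IsClosed (F : Set E))
    (hF : ∀ x ∈ F, L x ∈ F) {μ : ℂ} {x : E} (hxF : x ∉ F) (hx : L x - μ • x ∈ F) :
    ∃ y ∈ F ⊔ Submodule.span ℂ {x}, ‖y‖ ≤ 2 ∧ (∀ f ∈ F, 1 ≤ ‖y - f‖) ∧ L y - μ • y ∈ F := by
  have hne : (F : Set E).Nonempty := ⟨0, F.zero_mem⟩
  have hd : 0 < Metric.infDist x F := (hcl.notMem_iff_infDist_pos hne).1 hxF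
  set d := Metric.infDist x F
  obtain ⟨f, hfF, hf⟩ := (Metric.infDist_lt_iff hne).1 (show d < 2 * d by linarith)
  rw [dist_eq_norm] at hf
  have hdn : ‖((d : ℂ)⁻¹)‖ = d⁻¹ := by
    rw [norm_inv, Complex.norm_real, Real.norm_of_nonneg hd.le]
  have hdC : (d : ℂ) ≠ 0 := by exact_mod_cast hd.ne'
  refine ⟨(d : ℂ)⁻¹ • (x - f), ?_, ?_, fun g hg => ?_, ?_⟩
  · exact Submodule.smul_mem _ _ (Submodule.sub_mem _
      (Submodule.mem_sup_right (Submodule.mem_span_singleton_self x))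
      (Submodule.mem_sup_left hfF))
  · rw [norm_smul, hdn, inv_mul_le_iff₀ hd]
    linarith
  · have h1 : (d : ℂ)⁻¹ • (x - f) - g = (d : ℂ)⁻¹ • (x - (f + (d : ℂ) • g)) := by
      rw [← sub_sub, smul_sub _ (x - f), inv_smul_smul₀ hdC]
    rw [h1, norm_smul, hdn, le_inv_mul_iff₀ hd, mul_one, ← dist_eq_norm]
    exact Metric.infDist_le_dist_of_mem (F.add_mem hfF (F.smul_mem _ hg))
  · have h1 : L ((d : ℂ)⁻¹ • (x - f)) - μ • ((d : ℂ)⁻¹ • (x - f)) =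
        (d : ℂ)⁻¹ • ((L x - μ • x) - (L f - μ • f)) := by
      rw [map_smul, map_sub, smul_comm μ]
      simp only [smul_sub]
      abel
    rw [h1]
    exact F.smul_mem _ (F.sub_mem hx (F.sub_mem (hF f hfF) (F.smul_mem _ hfF)))

/-- There is no infinite flag of closed invariant subspaces along which `L` acts by scalars
`μ j` with `|μ j| ≥ r`, when some power `L ^ n` is close to a compact operator at scale `r ^ n`:
the Riesz vectors of the flag would have `r ^ n`-separated images under `L ^ n`. -/
theorem false_of_infinite_flag {L K : E →L[ℂ] E} (hK : IsCompactOperator K) {n : ℕ} {r : ℝ}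
    (hr : 0 < r) (hclose : ‖L ^ n - K‖ ≤ r ^ n / 8) {F : ℕ → Submodule ℂ E}
    (hcl : ∀ j, IsClosed (F j : Set E)) (hinv : ∀ j, ∀ x ∈ F j, L x ∈ F j) {x : ℕ → E} {μ : ℕ → ℂ}
    (hμ : ∀ j, r ≤ ‖μ j‖) (hxF : ∀ j, x j ∉ F j) (hx : ∀ j, L (x j) - μ j • x j ∈ F j)
    (hsucc : ∀ j, F (j + 1) = F j ⊔ Submodule.span ℂ {x j}) : False := by
  have hmono : Monotone F := monotone_nat_of_le_succ fun j => by rw [hsucc j]; exact le_sup_left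
  choose y hyF hy2 hyd hy using fun j => exists_riesz_vector (hcl j) (hinv j) (hxF j) (hx j)
  have hyF' : ∀ j, y j ∈ F (j + 1) := fun j => by rw [hsucc j]; exact hyF j
  have hrn : 0 < r ^ n := pow_pos hr n
  have hsep : ∀ i j, i < j → r ^ n / 2 ≤ ‖K (y j) - K (y i)‖ := by
    intro i j hij
    have hyi : y i ∈ F j := hmono hij (hyF' i)
    have hμn : r ^ n ≤ ‖μ j ^ n‖ := by
      rw [norm_pow]; exact pow_le_pow_left₀ hr.le (hμ j) n
    have hμ0 : μ j ^ n ≠ 0 := norm_pos_iff.1 (hrn.trans_le hμn)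
    have hmem : (L ^ n) (y i) - ((L ^ n) (y j) - μ j ^ n • y j) ∈ F j :=
      (F j).sub_mem (pow_apply_mem_of_invariant (hinv j) n hyi)
        (pow_apply_sub_mem_of_invariant (hinv j) (hy j) n)
    have h1 : r ^ n ≤ ‖(L ^ n) (y j) - (L ^ n) (y i)‖ := by
      have h2 := hyd j _ ((F j).smul_mem (μ j ^ n)⁻¹ hmem)
      have h3 : (L ^ n) (y j) - (L ^ n) (y i) = μ j ^ n • (y j -
          (μ j ^ n)⁻¹ • ((L ^ n) (y i) - ((L ^ n) (y j) - μ j ^ n • y j))) := by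
        rw [smul_sub, smul_inv_smul₀ hμ0]
        abel
      rw [h3, norm_smul]
      nlinarith [norm_nonneg (μ j ^ n)]
    have h4 : ‖(L ^ n - K) (y j - y i)‖ ≤ r ^ n / 8 * 4 :=
      (ContinuousLinearMap.le_opNorm _ _).trans (mul_le_mul hclose
        ((norm_sub_le _ _).trans (by linarith [hy2 i, hy2 j])) (norm_nonneg _) (by positivity))
    have h5 : (L ^ n) (y j) - (L ^ n) (y i) =
        (K (y j) - K (y i)) + (L ^ n - K) (y j - y i) := by
      rw [sub_apply, map_sub, map_sub]
      abel
    have h6 := norm_add_le (K (y j) - K (y i)) ((L ^ n - K) (y j - y i))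
    rw [← h5] at h6
    linarith
  obtain ⟨S, hS, hSK⟩ :=
    IsCompactOperator.image_closedBall_subset_compact (f := (K : E →ₗ[ℂ] E)) hK 2
  obtain ⟨a, -, φ, hφ, hlim⟩ := hS.tendsto_subseq (x := fun j => K (y j))
    (fun j => hSK ⟨y j, by simpa using hy2 j, rfl⟩)
  obtain ⟨N, hN⟩ := (Metric.cauchySeq_iff.1 hlim.cauchySeq) (r ^ n / 2) (by positivity)
  have h1 := hN (N + 1) (Nat.le_succ N) N le_rfl
  rw [dist_eq_norm] at h1
  exact absurd h1 (not_lt.2 (hsep _ _ (hφ (Nat.lt_succ_self N))))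

/-! ### Compressions to a complement of an invariant subspace -/

/-- `J` is a bounded operator that vanishes exactly on `F` and is the identity modulo `F`, i.e.
`1 - J` is a bounded projection onto `F`. -/
structure IsComplProj (F : Submodule ℂ E) (J : E →L[ℂ] E) : Prop where
  apply_eq_zero : ∀ x ∈ F, J x = 0
  sub_apply_mem : ∀ x, x - J x ∈ F

namespace IsComplProj

variable {F : Submodule ℂ E} {J L : E →L[ℂ] E}

theorem exists_of_finiteDimensional (F : Submodule ℂ E) [FiniteDimensional ℂ F] :
    ∃ J : E →L[ℂ] E, IsComplProj F J := by
  obtain ⟨π, hπ⟩ := Submodule.ClosedComplemented.of_finiteDimensional (𝕜 := ℂ) F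
  refine ⟨1 - F.subtypeL ∘L π, fun x hx => ?_, fun x => ?_⟩
  · have := hπ ⟨x, hx⟩
    simp [this]
  · simp

theorem mem_of_apply_eq_zero (hJ : IsComplProj F J) {x : E} (hx : J x = 0) : x ∈ F := by
  simpa [hx] using hJ.sub_apply_mem x

theorem mul_self (hJ : IsComplProj F J) : J * J = J := by
  ext x
  have := hJ.apply_eq_zero _ (hJ.sub_apply_mem x)
  rw [map_sub, sub_eq_zero] at this
  exact this.symm

/-- The compression `J L` is the operator induced by `L` on the quotient by `F`. -/
theorem mul_mul_self (hJ : IsComplProj F J) (hF : ∀ x ∈ F, L x ∈ F) : J * L * J = J * L := by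
  ext x
  have := hJ.apply_eq_zero _ (hF _ (hJ.sub_apply_mem x))
  rw [map_sub, map_sub, sub_eq_zero] at this
  exact this.symm

theorem semiconjBy (hJ : IsComplProj F J) (hF : ∀ x ∈ F, L x ∈ F) : SemiconjBy J L (J * L) :=
  (hJ.mul_mul_self hF).symm

theorem commute (hJ : IsComplProj F J) (hF : ∀ x ∈ F, L x ∈ F) : Commute J (J * L) := by
  rw [Commute, SemiconjBy, hJ.mul_mul_self hF, ← mul_assoc, hJ.mul_self]

theorem compression_pow (hJ : IsComplProj F J) (hF : ∀ x ∈ F, L x ∈ F) {n : ℕ} (hn : n ≠ 0) :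
    (J * L) ^ n = J * L ^ n := by
  rw [((hJ.semiconjBy hF).pow_right n).eq]
  obtain ⟨m, rfl⟩ := Nat.exists_eq_succ_of_ne_zero hn
  rw [pow_succ, mul_assoc _ (J * L), hJ.mul_mul_self hF]

end IsComplProj

/-- `L ^ n` is at distance `O(ρ ^ n)` from the compact operators. -/
def IsNearCompact (L : E →L[ℂ] E) (ρ : ℝ) : Prop :=
  ∃ C : ℝ, ∀ᶠ n : ℕ in atTop, ∃ K : E →L[ℂ] E, IsCompactOperator K ∧ ‖L ^ n - K‖ ≤ C * ρ ^ n

theorem eventually_mul_pow_lt {ρ r : ℝ} (hρ : 0 ≤ ρ) (hr : ρ < r) (C : ℝ) {ε : ℝ} (hε : 0 < ε) :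
    ∀ᶠ n : ℕ in atTop, C * ρ ^ n < ε * r ^ n := by
  have hr0 : 0 < r := hρ.trans_lt hr
  have h : Tendsto (fun n : ℕ => C * (ρ / r) ^ n) atTop (𝓝 (C * 0)) :=
    (tendsto_pow_atTop_nhds_zero_of_lt_one (div_nonneg hρ hr0.le)
      ((div_lt_one hr0).2 hr)).const_mul C
  rw [mul_zero] at h
  filter_upwards [h.eventually_lt_const hε] with n hn
  rwa [div_pow, mul_div_assoc', div_lt_iff₀ (pow_pos hr0 n)] at hn

/-- Either the operator induced by `L` on the quotient by `F` has its spectrum in `|z| < r`, or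
`F` can be enlarged by a vector that is an eigenvector modulo `F` for an eigenvalue of modulus at
least `r`. -/
theorem IsNearCompact.compression_spectrum_or_exists [CompleteSpace E] {L : E →L[ℂ] E} {ρ r : ℝ}
    (hL : IsNearCompact L ρ) (hρ : 0 ≤ ρ) (hr : ρ < r) {F : Submodule ℂ E} {J : E →L[ℂ] E}
    (hJ : IsComplProj F J) (hF : ∀ x ∈ F, L x ∈ F) :
    (∀ μ ∈ spectrum ℂ (J * L), ‖μ‖ < r) ∨
      ∃ x ∉ F, ∃ μ : ℂ, r ≤ ‖μ‖ ∧ L x - μ • x ∈ F := by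
  refine or_iff_not_imp_left.2 fun h => ?_
  push Not at h
  obtain ⟨μ, hμ, hrμ⟩ := h
  obtain ⟨C, hC⟩ := hL
  obtain ⟨n, ⟨K, hK, hKn⟩, hn, hn0⟩ := (hC.and ((eventually_mul_pow_lt hρ hr (‖J‖ * C)
    one_pos).and (eventually_ne_atTop 0))).exists
  have hlt : ‖(J * L) ^ n - J * K‖ < ‖μ‖ ^ n := by
    rw [hJ.compression_pow hF hn0, ← mul_sub]
    calc ‖J * (L ^ n - K)‖ ≤ ‖J‖ * ‖L ^ n - K‖ := norm_mul_le _ _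
      _ ≤ ‖J‖ * (C * ρ ^ n) := mul_le_mul_of_nonneg_left hKn (norm_nonneg _)
      _ < r ^ n := by rw [← mul_assoc, ← one_mul (r ^ n)]; exact hn
      _ ≤ ‖μ‖ ^ n := pow_le_pow_left₀ (hρ.trans hr.le) hrμ n
  obtain ⟨ν, hν, y, hy0, hy⟩ :=
    exists_eigenvector_of_mem_spectrum (J * L) (J * K) (hK.clm_comp J) hn0 hμ hlt
  have hr0 : 0 < r := hρ.trans_lt hr
  have hν0 : ν ≠ 0 := norm_pos_iff.1 (by rw [hν]; linarith)
  -- `y` lies in the range of `J`, so it is fixed by `J` and nonzero modulo `F`.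
  have hJy : J y = y := by
    have h1 : J (ν • y) = ν • y := by
      rw [← hy, ← mul_apply_eq_comp, ← mul_assoc, hJ.mul_self]
    rw [map_smul] at h1
    exact smul_right_injective E hν0 h1
  refine ⟨y, fun hyF => hy0 (by rw [← hJy, hJ.apply_eq_zero y hyF]), ν, hν ▸ hrμ, ?_⟩
  have := hJ.sub_apply_mem (L y)
  rwa [show J (L y) = ν • y from hy] at this

/-- `F` is a finite-dimensional subspace invariant under `L` on which all eigenvalues of `L` have
modulus at least `r`. -/
structure IsPeripheral (L : E →L[ℂ] E) (r : ℝ) (F : Submodule ℂ E) : Prop where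
  finiteDimensional : FiniteDimensional ℂ F
  apply_mem : ∀ x ∈ F, L x ∈ F
  le_norm : ∀ x ∈ F, x ≠ 0 → ∀ μ : ℂ, L x = μ • x → r ≤ ‖μ‖

theorem IsPeripheral.bot (L : E →L[ℂ] E) (r : ℝ) : IsPeripheral L r ⊥ where
  finiteDimensional := inferInstance
  apply_mem := by simp
  le_norm := by simp

theorem IsPeripheral.sup_span {L : E →L[ℂ] E} {r : ℝ} {F : Submodule ℂ E}
    (hF : IsPeripheral L r F) {x : E} {μ : ℂ} (hxF : x ∉ F) (hμ : r ≤ ‖μ‖)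
    (hx : L x - μ • x ∈ F) : IsPeripheral L r (F ⊔ Submodule.span ℂ {x}) where
  finiteDimensional := by
    have := hF.finiteDimensional
    infer_instance
  apply_mem := by
    intro y hy
    obtain ⟨f, hf, z, hz, rfl⟩ := Submodule.mem_sup.1 hy
    obtain ⟨c, rfl⟩ := Submodule.mem_span_singleton.1 hz
    have : L (f + c • x) = (L f + c • (L x - μ • x)) + (c * μ) • x := by
      rw [map_add, map_smul, smul_sub, smul_smul]; abel
    rw [this]
    exact Submodule.add_mem_sup (F.add_mem (hF.apply_mem f hf) (F.smul_mem _ hx))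
      (Submodule.smul_mem _ _ (Submodule.mem_span_singleton_self x))
  le_norm := by
    intro y hy hy0 ν hν
    obtain ⟨f, hf, z, hz, rfl⟩ := Submodule.mem_sup.1 hy
    obtain ⟨c, rfl⟩ := Submodule.mem_span_singleton.1 hz
    have h1 : (c * (ν - μ)) • x ∈ F := by
      have h2 : (c * (ν - μ)) • x = L f + c • (L x - μ • x) - ν • f := by
        rw [map_add, map_smul, smul_add] at hν
        rw [mul_sub, sub_smul, smul_sub, smul_smul, ← sub_eq_zero, mul_comm c ν, ← smul_smul ν c]
        rw [← sub_eq_zero] at hν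
        rw [← neg_eq_zero, ← hν]
        abel
      rw [h2]
      exact F.sub_mem (F.add_mem (hF.apply_mem f hf) (F.smul_mem _ hx)) (F.smul_mem _ hf)
    by_cases hc : c * (ν - μ) = 0
    · rcases mul_eq_zero.1 hc with rfl | h
      · rw [zero_smul, add_zero] at hy0 hν
        exact hF.le_norm f hf hy0 ν hν
      · rwa [sub_eq_zero.1 h]
    · exact absurd ((F.smul_mem_iff hc).1 h1) hxF

/-- Some finite-dimensional invariant subspace `F` carries all the spectrum of `L` in `|z| ≥ r`. -/
theorem IsNearCompact.exists_isPeripheral [CompleteSpace E] {L : E →L[ℂ] E} {ρ r : ℝ}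
    (hL : IsNearCompact L ρ) (hρ : 0 ≤ ρ) (hr : ρ < r) :
    ∃ (F : Submodule ℂ E) (J : E →L[ℂ] E), IsPeripheral L r F ∧ IsComplProj F J ∧
      ∀ μ ∈ spectrum ℂ (J * L), ‖μ‖ < r := by
  by_contra hcon
  have hstep : ∀ F : {F : Submodule ℂ E // IsPeripheral L r F},
      ∃ x ∉ F.1, ∃ μ : ℂ, r ≤ ‖μ‖ ∧ L x - μ • x ∈ F.1 := by
    rintro ⟨F, hF⟩
    have := hF.finiteDimensional
    obtain ⟨J, hJ⟩ := IsComplProj.exists_of_finiteDimensional F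
    exact (hL.compression_spectrum_or_exists hρ hr hJ hF.apply_mem).resolve_left
      fun h => hcon ⟨F, J, hF, hJ, h⟩
  choose x hxF μ hμ hx using hstep
  -- If the spectrum in `|z| ≥ r` were never exhausted, the enlargements would form an infinite
  -- flag.
  let F : ℕ → {F : Submodule ℂ E // IsPeripheral L r F} := fun j =>
    Nat.rec ⟨⊥, IsPeripheral.bot L r⟩
      (fun _ F => ⟨_, F.2.sup_span (hxF F) (hμ F) (hx F)⟩) j
  obtain ⟨C, hC⟩ := hL
  obtain ⟨n, ⟨K, hK, hKn⟩, hn⟩ := (hC.and (eventually_mul_pow_lt hρ hr C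
    (show (0 : ℝ) < 1 / 8 by norm_num))).exists
  refine false_of_infinite_flag (L := L) (n := n) (F := fun j => (F j).1) hK (hρ.trans_lt hr)
    (by linarith) (fun j => ?_) (fun j => (F j).2.apply_mem)
    (fun j => hμ (F j)) (fun j => hxF (F j)) (fun j => hx (F j)) (fun j => rfl)
  have := (F j).2.finiteDimensional
  exact (F j).1.closed_of_finiteDimensional

end SpectralDecomposition

/-! ### The invariant decomposition -/

section PeripheralDecomposition

open Polynomial

theorem SemiconjBy.aeval_right {A : Type*} [Ring A] [Algebra ℂ A] {J a b : A}
    (h : SemiconjBy J a b) (q : ℂ[X]) : SemiconjBy J (aeval a q) (aeval b q) := by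
  induction q using Polynomial.induction_on' with
  | add p q hp hq => rw [map_add, map_add]; exact hp.add_right hq
  | monomial n c =>
    rw [aeval_monomial, aeval_monomial]
    exact SemiconjBy.mul_right (Algebra.commutes c J).symm (h.pow_right n)

theorem isUnit_aeval_of_forall_root_notMem_spectrum {A : Type*} [Ring A] [Algebra ℂ A] {a : A}
    {q : ℂ[X]} (hq : q.Monic) (h : ∀ z, q.IsRoot z → z ∉ spectrum ℂ a) : IsUnit (aeval a q) := by
  by_contra hu
  rw [(IsAlgClosed.splits q).eq_prod_roots_of_monic hq] at hu
  obtain ⟨k, hk, hk0⟩ := spectrum.exists_mem_of_not_isUnit_aeval_prod hu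
  exact h k hk0 hk

/-- A consequence of Gelfand's formula. -/
theorem exists_norm_pow_le_of_forall_spectrum_lt {A : Type*} [NormedRing A] [NormedAlgebra ℂ A]
    [CompleteSpace A] [Nontrivial A] {a : A} {r : ℝ} (hr : 0 < r)
    (h : ∀ z ∈ spectrum ℂ a, ‖z‖ < r) : ∃ C : ℝ, ∀ n : ℕ, ‖a ^ n‖ ≤ C * r ^ n := by
  have h1 : spectralRadius ℂ a < ENNReal.ofReal r :=
    spectrum.spectralRadius_lt_of_forall_lt (r := r.toNNReal) a fun z hz => by
      rw [← NNReal.coe_lt_coe, Real.coe_toNNReal r hr.le]; exact h z hz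
  have h2 := (spectrum.pow_norm_pow_one_div_tendsto_nhds_spectralRadius a).eventually_lt_const h1
  obtain ⟨N, hN⟩ := eventually_atTop.1 (h2.and (eventually_ne_atTop 0))
  have hN' : ∀ n, N ≤ n → ‖a ^ n‖ ≤ r ^ n := fun n hn => by
    obtain ⟨h3, hn0⟩ := hN n hn
    have h4 := ((ENNReal.ofReal_lt_ofReal_iff hr).1 h3).le
    have h5 := pow_le_pow_left₀ (by positivity) h4 n
    rwa [← Real.rpow_natCast, ← Real.rpow_mul (norm_nonneg _), one_div,
      inv_mul_cancel₀ (by exact_mod_cast hn0), Real.rpow_one] at h5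
  refine ⟨1 + ∑ i ∈ Finset.range N, ‖a ^ i‖ / r ^ i, fun n => ?_⟩
  have hsum : 0 ≤ ∑ i ∈ Finset.range N, ‖a ^ i‖ / r ^ i :=
    Finset.sum_nonneg fun i _ => by positivity
  have hrn : 0 < r ^ n := pow_pos hr n
  rcases lt_or_ge n N with hn | hn
  · have := Finset.single_le_sum (f := fun i => ‖a ^ i‖ / r ^ i) (fun i _ => by positivity)
      (Finset.mem_range.2 hn)
    rw [← div_le_iff₀ hrn]
    linarith
  · exact (hN' n hn).trans (le_mul_of_one_le_left hrn.le (by linarith))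

variable {E : Type*} [NormedAddCommGroup E] [NormedSpace ℂ E]

theorem coe_aeval_restrict (L : E →L[ℂ] E) {F : Submodule ℂ E} (hF : ∀ x ∈ F, L x ∈ F) (q : ℂ[X])
    (y : F) : ((aeval ((L : E →ₗ[ℂ] E).restrict hF) q y : F) : E) = aeval L q (y : E) := by
  induction q using Polynomial.induction_on' with
  | add p q hp hq => simp [hp, hq]
  | monomial n c =>
    have h : ((((L : E →ₗ[ℂ] E).restrict hF) ^ n) y : E) = (L ^ n) (y : E) := by
      induction n with
      | zero => simp
      | succ n ih =>
        rw [pow_succ', pow_succ', Module.End.mul_apply, mul_apply_eq_comp, ← ih]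
        rfl
    rw [aeval_monomial, aeval_monomial, Algebra.algebraMap_eq_smul_one,
      Algebra.algebraMap_eq_smul_one, smul_one_mul, smul_one_mul, LinearMap.smul_apply, smul_apply,
      Submodule.coe_smul, h]

theorem aeval_X_sub_C_pow (L : E →L[ℂ] E) (z : ℂ) (p : ℕ) :
    aeval L ((X - C z) ^ p) = (L - z • ContinuousLinearMap.id ℂ E) ^ p := by
  rw [map_pow, map_sub, aeval_X, aeval_C, Algebra.algebraMap_eq_smul_one]
  rfl

theorem mem_genKer_iff {L : E →L[ℂ] E} {z : ℂ} {p : ℕ} {x : E} :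
    x ∈ genKer L z p ↔ aeval L ((X - C z) ^ p) x = 0 := by
  rw [aeval_X_sub_C_pow]
  rfl

theorem mem_genEigenspace_iff_aeval {V : Type*} [AddCommGroup V] [Module ℂ V]
    {f : Module.End ℂ V} {z : ℂ} {p : ℕ} {x : V} :
    x ∈ f.genEigenspace z p ↔ aeval f ((X - C z) ^ p) x = 0 := by
  rw [Module.End.mem_genEigenspace_nat, map_pow, map_sub, aeval_X, aeval_C,
    Algebra.algebraMap_eq_smul_one, LinearMap.mem_ker]

theorem genKer_eq_genEigenspace (L : E →L[ℂ] E) (z : ℂ) (p : ℕ) :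
    genKer L z p = Module.End.genEigenspace (L : E →ₗ[ℂ] E) z p := by
  ext x
  rw [Module.End.mem_genEigenspace_nat, genKer, ContinuousLinearMap.toLinearMap_pow]
  rfl

/-- When `q(J L)` is invertible, the kernel of `q(L)` is contained in `F`. -/
theorem IsComplProj.mem_of_aeval_apply_eq_zero {L J : E →L[ℂ] E} {F : Submodule ℂ E}
    (hJ : IsComplProj F J) (hF : ∀ x ∈ F, L x ∈ F) {q : ℂ[X]} (hq : IsUnit (aeval (J * L) q))
    {x : E} (hx : aeval L q x = 0) : x ∈ F := by
  obtain ⟨R, hR⟩ := hq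
  have h1 : (aeval (J * L) q) (J x) = 0 := by
    have := congrArg (fun T : E →L[ℂ] E => T x) ((hJ.semiconjBy hF).aeval_right q).eq
    simp only [mul_apply_eq_comp, hx, map_zero] at this
    exact this.symm
  refine hJ.mem_of_apply_eq_zero ?_
  rw [← hR] at h1
  calc J x = ((↑R⁻¹ : E →L[ℂ] E) * (R : E →L[ℂ] E)) (J x) := by
        rw [Units.inv_mul, one_apply_eq_self]
    _ = 0 := by rw [mul_apply_eq_comp, h1, map_zero]

/-- If `q(L)` vanishes on `F` and `q(J L)` is invertible, then `Π = q(L) q(J L)⁻¹ J` is a bounded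
projection with kernel `F` that commutes with `L`. Moreover the powers of `L` on its range are
controlled by those of the compression `J L`. -/
theorem IsComplProj.exists_commute {L J : E →L[ℂ] E} {F : Submodule ℂ E}
    (hJ : IsComplProj F J) (hF : ∀ x ∈ F, L x ∈ F) {q : ℂ[X]} (hq : IsUnit (aeval (J * L) q))
    (hqF : ∀ x ∈ F, aeval L q x = 0) :
    ∃ p : E →L[ℂ] E, IsComplProj F p ∧ Commute L p ∧
      ∃ C : ℝ, ∀ n : ℕ, ‖p * L ^ n‖ ≤ C * ‖(J * L) ^ n‖ := by
  obtain ⟨R, hR⟩ := hq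
  set Q := aeval L q
  set M := J * L
  set T : E →L[ℂ] E := ↑R⁻¹
  have hJL : J * L = M * J := hJ.semiconjBy hF
  have hJQ : J * Q = R * J := by rw [hR]; exact (hJ.semiconjBy hF).aeval_right q
  have hJT : J * T = T * J := by
    have : Commute J (R : E →L[ℂ] E) := by rw [hR]; exact (hJ.commute hF).aeval_right q
    exact this.units_inv_right
  have hMT : M * T = T * M := by
    have : Commute M (R : E →L[ℂ] E) := by rw [hR]; exact (Commute.refl M).aeval_right q
    exact this.units_inv_right
  have hQJ : Q * J = Q := by
    ext x
    have := hqF _ (hJ.sub_apply_mem x)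
    rw [map_sub, sub_eq_zero] at this
    exact this.symm
  have hLQ : L * Q = Q * L := (Commute.refl L).aeval_right q
  have hJp : J * (Q * T * J) = J := by
    calc J * (Q * T * J) = (J * Q) * T * J := by simp only [mul_assoc]
      _ = R * (J * T) * J := by rw [hJQ, mul_assoc (R : E →L[ℂ] E)]
      _ = (R * T) * (J * J) := by rw [hJT]; simp only [mul_assoc]
      _ = J := by rw [Units.mul_inv, one_mul, hJ.mul_self]
  refine ⟨Q * T * J, ⟨fun x hx => ?_, fun x => ?_⟩, ?_, ‖Q * T‖ * ‖J‖, fun n => ?_⟩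
  · rw [mul_apply_eq_comp, hJ.apply_eq_zero x hx, map_zero]
  · refine hJ.mem_of_apply_eq_zero ?_
    rw [map_sub, ← mul_apply_eq_comp J, hJp, sub_self]
  · calc L * (Q * T * J) = Q * L * (T * J) := by rw [← hLQ]; simp only [mul_assoc]
      _ = Q * J * L * (T * J) := by rw [hQJ]
      _ = Q * M * (J * T) * J := by rw [mul_assoc Q J L, hJL]; simp only [mul_assoc]
      _ = Q * (M * T) * (J * J) := by rw [hJT]; simp only [mul_assoc]
      _ = Q * T * (J * L) := by rw [hMT, hJ.mul_self, hJL]; simp only [mul_assoc]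
      _ = Q * T * J * L := by simp only [mul_assoc]
  · calc ‖Q * T * J * L ^ n‖ = ‖Q * T * (M ^ n * J)‖ := by
          rw [mul_assoc, ((hJ.semiconjBy hF).pow_right n).eq]
      _ ≤ ‖Q * T‖ * (‖M ^ n‖ * ‖J‖) :=
          (norm_mul_le _ _).trans (mul_le_mul_of_nonneg_left (norm_mul_le _ _) (norm_nonneg _))
      _ = ‖Q * T‖ * ‖J‖ * ‖M ^ n‖ := by ring

theorem IsPeripheral.le_norm_of_hasEigenvalue {L : E →L[ℂ] E} {r : ℝ} {F : Submodule ℂ E}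
    (hF : IsPeripheral L r F) {z : ℂ}
    (hz : Module.End.HasEigenvalue ((L : E →ₗ[ℂ] E).restrict hF.apply_mem) z) : r ≤ ‖z‖ := by
  obtain ⟨y, hy⟩ := hz.exists_hasEigenvector
  refine hF.le_norm y y.2 (fun h => hy.2 (Subtype.ext h)) z ?_
  exact congrArg Subtype.val hy.apply_eq_smul

/-- A nonzero peripheral subspace is the direct sum of the generalized eigenspaces of `L` for its
finitely many eigenvalues on that subspace, provided that `L` has no further generalized
eigenvectors for these eigenvalues. -/
theorem IsPeripheral.exists_genKer_decomposition {L : E →L[ℂ] E} {r : ℝ} {F : Submodule ℂ E}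
    (hF : IsPeripheral L r F) (hne : F ≠ ⊥)
    (hle : ∀ (z : ℂ) (p : ℕ), r ≤ ‖z‖ → genKer L z p ≤ F) :
    ∃ (m : ℕ) (z : Fin m → ℂ) (p : Fin m → ℕ), 1 ≤ m ∧ (∀ i, 1 ≤ p i) ∧
      iSupIndep (fun i => genKer L (z i) (p i)) ∧ ⨆ i, genKer L (z i) (p i) = F ∧
      (∀ i, r ≤ ‖z i‖) ∧ ∀ i, genKer L (z i) (p i) ≠ ⊥ := by
  have hfd := hF.finiteDimensional
  have hnt : Nontrivial F := Submodule.nontrivial_iff_ne_bot.2 hne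
  set f : Module.End ℂ F := (L : E →ₗ[ℂ] E).restrict hF.apply_mem with hf
  set k := Module.finrank ℂ F
  have hk : 1 ≤ k := Module.finrank_pos
  have hmap : ∀ z : ℂ, (f.genEigenspace z k).map F.subtype ≤ genKer L z k := by
    rintro z _ ⟨y, hy, rfl⟩
    have h := mem_genEigenspace_iff_aeval.1 hy
    rw [mem_genKer_iff, Submodule.subtype_apply, ← coe_aeval_restrict L hF.apply_mem, ← hf, h]
    rfl
  let e := Fintype.equivFin f.Eigenvalues
  let z : Fin (Fintype.card f.Eigenvalues) → ℂ := fun i => (e.symm i).val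
  have hz : ∀ i, f.HasEigenvalue (z i) := fun i => (e.symm i).2
  refine ⟨Fintype.card f.Eigenvalues, z, fun _ => k, ?_, fun _ => hk, ?_, le_antisymm ?_ ?_,
    fun i => hF.le_norm_of_hasEigenvalue (hz i), fun i h => ?_⟩
  · obtain ⟨μ, hμ⟩ := Module.End.exists_eigenvalue f
    exact Fintype.card_pos_iff.2 ⟨⟨μ, hμ⟩⟩
  · simp_rw [genKer_eq_genEigenspace]
    exact (Module.End.independent_genEigenspace (L : E →ₗ[ℂ] E) k).comp
      (f := z) fun i j hij => e.symm.injective (Subtype.ext hij)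
  · exact iSup_le fun i => hle _ _ (hF.le_norm_of_hasEigenvalue (hz i))
  · have htop := Module.End.iSup_maxGenEigenspace_eq_top f
    calc F = (⊤ : Submodule ℂ F).map F.subtype := by rw [Submodule.map_top, Submodule.range_subtype]
      _ ≤ ⨆ i, genKer L (z i) k := by
        rw [← htop, Submodule.map_iSup]
        refine iSup_le fun μ => ?_
        by_cases hμ : f.HasEigenvalue μ
        · refine le_trans ?_ (le_iSup _ (e ⟨μ, hμ⟩))
          have hzμ : z (e ⟨μ, hμ⟩) = μ := congrArg Subtype.val (e.symm_apply_apply ⟨μ, hμ⟩)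
          rw [Module.End.maxGenEigenspace_eq_genEigenspace_finrank, hzμ]
          exact hmap μ
        · have hbot : f.maxGenEigenspace μ = ⊥ := by
            by_contra hb
            have h1 : f.HasUnifEigenvalue μ k := by
              rwa [Module.End.HasUnifEigenvalue,
                ← Module.End.maxGenEigenspace_eq_genEigenspace_finrank]
            exact hμ (h1.lt zero_lt_one)
          rw [hbot, Submodule.map_bot]
          exact bot_le
  · obtain ⟨y, hy⟩ := (hz i).exists_hasEigenvector
    have h1 : y ∈ f.genEigenspace (z i) k :=
      (f.genEigenspace (z i)).monotone (by exact_mod_cast hk) hy.1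
    have h2 : (y : E) ∈ genKer L (z i) k := hmap (z i) ⟨y, h1, rfl⟩
    rw [h, Submodule.mem_bot] at h2
    exact hy.2 (Subtype.ext h2)

/-- Quasi-compactness: an operator whose powers `L ^ n` are `O(ρ ^ n)`-close to compact operators
has a spectral decomposition for every radius between `ρ` and its spectral radius. -/
theorem IsNearCompact.hasSpectralDecomp [CompleteSpace E] {L : E →L[ℂ] E} {ρ r : ℝ}
    (hL : IsNearCompact L ρ) (hρ : 0 ≤ ρ) (hr : ρ < r)
    (hrL : ∃ z ∈ spectrum ℂ L, r ≤ ‖z‖) : HasSpectralDecomp L r := by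
  have hr0 : 0 < r := hρ.trans_lt hr
  obtain ⟨F, J, hF, hJ, hspec⟩ := hL.exists_isPeripheral hρ hr
  have hfd := hF.finiteDimensional
  obtain ⟨z₀, hz₀, hrz₀⟩ := hrL
  have hNontriv : Nontrivial (E →L[ℂ] E) := by
    by_contra hE
    rw [not_nontrivial_iff_subsingleton] at hE
    simp [spectrum.of_subsingleton] at hz₀
  have hne : F ≠ ⊥ := by
    rintro rfl
    have hJ1 : J = 1 := by
      ext x
      exact (sub_eq_zero.1 ((Submodule.mem_bot ℂ).1 (hJ.sub_apply_mem x))).symm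
    rw [hJ1, one_mul] at hspec
    exact absurd hrz₀ (not_le.2 (hspec z₀ hz₀))
  have hunit : ∀ q : ℂ[X], q.Monic → (∀ z, q.IsRoot z → r ≤ ‖z‖) → IsUnit (aeval (J * L) q) :=
    fun q hq h => isUnit_aeval_of_forall_root_notMem_spectrum hq fun z hz hzs =>
      absurd (h z hz) (not_le.2 (hspec z hzs))
  have hle : ∀ (z : ℂ) (p : ℕ), r ≤ ‖z‖ → genKer L z p ≤ F := fun z p hz x hx => by
    refine hJ.mem_of_aeval_apply_eq_zero hF.apply_mem
      (hunit _ ((monic_X_sub_C z).pow p) fun w hw => ?_) (mem_genKer_iff.1 hx)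
    have hwz : w = z := by
      rw [IsRoot.def, eval_pow, eval_sub, eval_X, eval_C] at hw
      exact sub_eq_zero.1 (eq_zero_of_pow_eq_zero hw)
    rwa [hwz]
  set f : Module.End ℂ F := (L : E →ₗ[ℂ] E).restrict hF.apply_mem with hf
  obtain ⟨p, hp, hcomm, C, hC⟩ := hJ.exists_commute hF.apply_mem (q := minpoly ℂ f)
    (hunit _ (minpoly.monic (Algebra.IsIntegral.isIntegral f)) fun z hz =>
      hF.le_norm_of_hasEigenvalue (Module.End.hasEigenvalue_of_isRoot hz))
    (fun x hx => by
      rw [← coe_aeval_restrict L hF.apply_mem _ ⟨x, hx⟩, ← hf, minpoly.aeval]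
      rfl)
  obtain ⟨D, hD⟩ := exists_norm_pow_le_of_forall_spectrum_lt hr0 hspec
  obtain ⟨m, z, e, hm, he, hind, hsup, hz, hbot⟩ := hF.exists_genKer_decomposition hne hle
  have hmem : ∀ x, x ∈ LinearMap.ker ((1 - p : E →L[ℂ] E) : E →ₗ[ℂ] E) ↔ p x = x := fun x => by
    rw [LinearMap.mem_ker]
    change x - p x = 0 ↔ _
    rw [sub_eq_zero, eq_comm]
  refine ⟨m, z, e, LinearMap.ker ((1 - p : E →L[ℂ] E) : E →ₗ[ℂ] E), hm, he, hind, ?_, hz, hbot,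
    fun i => Submodule.finiteDimensional_of_le (hle _ _ (hz i)), (1 - p).isClosed_ker,
    fun h hh => ?_, |C| * D, fun n h hh h1 => ?_⟩
  · rw [hsup]
    refine IsCompl.of_eq ?_ ?_
    · refine (Submodule.eq_bot_iff _).2 fun x hx => ?_
      rw [← (hmem x).1 hx.2, hp.apply_eq_zero x hx.1]
    · refine (Submodule.eq_top_iff').2 fun x => ?_
      rw [← sub_add_cancel x (p x)]
      refine Submodule.add_mem_sup (hp.sub_apply_mem x) ((hmem _).2 ?_)
      rw [← mul_apply_eq_comp, hp.mul_self]
  · rw [hmem] at hh ⊢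
    rw [← mul_apply_eq_comp, ← hcomm.eq, mul_apply_eq_comp, hh]
  · have h2 : (L ^ n) h = (p * L ^ n) h := by
      rw [← (hcomm.pow_left n).eq, mul_apply_eq_comp, (hmem h).1 hh]
    rw [h2]
    calc ‖(p * L ^ n) h‖ ≤ ‖p * L ^ n‖ * ‖h‖ := ContinuousLinearMap.le_opNorm _ _
      _ ≤ ‖p * L ^ n‖ := mul_le_of_le_one_right (norm_nonneg _) h1
      _ ≤ C * ‖(J * L) ^ n‖ := hC n
      _ ≤ |C| * (D * r ^ n) := mul_le_mul (le_abs_self C) (hD n) (norm_nonneg _) (abs_nonneg C)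
      _ = |C| * D * r ^ n := by ring

end PeripheralDecomposition

/-! ### The essential spectral radius -/

section EssentialSpectralRadius

variable {E : Type*} [NormedAddCommGroup E] [NormedSpace ℂ E]

theorem IsNearCompact.essSpectralRadius_le {L : E →L[ℂ] E} {ρ : ℝ} (hL : IsNearCompact L ρ)
    (hρ : 0 < ρ) : essSpectralRadius L ≤ ρ := by
  obtain ⟨C, hC⟩ := hL
  have hD : 0 < max C 1 := lt_max_of_lt_right one_pos
  have hinf : ∀ n : ℕ, 0 ≤ ⨅ K : {K : E →L[ℂ] E // IsCompactOperator K}, ‖L ^ n - K.1‖ :=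
    fun n => Real.iInf_nonneg fun K => norm_nonneg _
  have hlim : Tendsto (fun n : ℕ => (max C 1) ^ (1 / (n : ℝ)) * ρ) atTop (𝓝 ρ) := by
    have h0 : Tendsto (fun n : ℕ => 1 / (n : ℝ)) atTop (𝓝 0) := tendsto_one_div_atTop_nhds_zero_nat
    have := ((tendsto_const_nhds (x := max C 1)).rpow h0 (Or.inl hD.ne')).mul_const ρ
    simpa using this
  have hle : ∀ᶠ n : ℕ in atTop,
      (⨅ K : {K : E →L[ℂ] E // IsCompactOperator K}, ‖L ^ n - K.1‖) ^ (1 / (n : ℝ)) ≤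
        (max C 1) ^ (1 / (n : ℝ)) * ρ := by
    filter_upwards [hC, eventually_ne_atTop 0] with n ⟨K, hK, hKn⟩ hn
    have h1 : (⨅ K : {K : E →L[ℂ] E // IsCompactOperator K}, ‖L ^ n - K.1‖) ≤ max C 1 * ρ ^ n :=
      (ciInf_le ⟨0, by rintro _ ⟨K, rfl⟩; exact norm_nonneg _⟩
        (⟨K, hK⟩ : {K : E →L[ℂ] E // IsCompactOperator K})).trans
        (hKn.trans (mul_le_mul_of_nonneg_right (le_max_left _ _) (pow_nonneg hρ.le n)))
    refine (Real.rpow_le_rpow (hinf n) h1 (by positivity)).trans_eq ?_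
    rw [Real.mul_rpow hD.le (pow_nonneg hρ.le n), one_div, Real.pow_rpow_inv_natCast hρ.le hn]
  refine (limsup_le_limsup hle ?_ hlim.isBoundedUnder_le).trans_eq hlim.limsup_eq
  exact IsBoundedUnder.isCoboundedUnder_le
    ⟨0, eventually_map.2 (Eventually.of_forall fun n => Real.rpow_nonneg (hinf n) _)⟩

end EssentialSpectralRadius

/-! ### Markov kernels on weighted spaces -/

section MarkovKernels

variable {X : Type*} [MeasurableSpace X] {V : Weight X} {P : Kernel X X}

namespace BSpace

theorem sub_apply (f g : BSpace V) (x : X) : (f - g) x = f x - g x := rfl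

instance : CompleteSpace (BSpace V) := by
  refine Metric.complete_of_cauchySeq_tendsto fun u hu => ?_
  have hle : ∀ m n x, dist (u m x) (u n x) ≤ dist (u m) (u n) * V x := fun m n x => by
    rw [dist_eq_norm, dist_eq_norm, ← sub_apply]
    exact norm_apply_le _ x
  have hpt : ∀ x, ∃ a, Tendsto (fun n => u n x) atTop (𝓝 a) := fun x => by
    refine cauchySeq_tendsto_of_complete (Metric.cauchySeq_iff.2 fun ε hε => ?_)
    obtain ⟨N, hN⟩ := Metric.cauchySeq_iff.1 hu (ε / V x) (div_pos hε (V.pos x))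
    exact ⟨N, fun m hm n hn => (hle m n x).trans_lt ((lt_div_iff₀ (V.pos x)).1 (hN m hm n hn))⟩
  choose g hg using hpt
  obtain ⟨C, hC⟩ := hu.norm_bddAbove
  have hgm : Measurable g :=
    measurable_of_tendsto_metrizable (fun n => (u n).measurable) (tendsto_pi_nhds.2 hg)
  let G : BSpace V := ⟨g, hgm, C, fun x => le_of_tendsto (hg x).norm (Eventually.of_forall fun n =>
    (norm_apply_le (u n) x).trans
      (mul_le_mul_of_nonneg_right (hC ⟨n, rfl⟩) (V.pos x).le))⟩
  refine ⟨G, Metric.tendsto_atTop.2 fun ε hε => ?_⟩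
  obtain ⟨N, hN⟩ := Metric.cauchySeq_iff.1 hu (ε / 2) (half_pos hε)
  refine ⟨N, fun n hn => lt_of_le_of_lt ?_ (half_lt_self hε)⟩
  rw [dist_eq_norm]
  refine norm_le_of_forall _ (half_pos hε).le fun x => ?_
  rw [sub_apply, ← dist_eq_norm]
  refine le_of_tendsto (tendsto_const_nhds.dist (hg x)) ?_
  filter_upwards [eventually_ge_atTop N] with m hm
  exact (hle n m x).trans (mul_le_mul_of_nonneg_right (hN n hn m hm).le (V.pos x).le)

end BSpace

theorem enorm_kernelOp_pow_apply_le (h : ActsOn P V) (n : ℕ) (f : BSpace V) (x : X) :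
    ‖(kernelOp P V h ^ n) f x‖ₑ ≤ ENNReal.ofReal ‖f‖ * iterWeight P V n x := by
  induction n generalizing x with
  | zero =>
    change ‖f x‖ₑ ≤ ENNReal.ofReal ‖f‖ * ENNReal.ofReal (V x)
    rw [← ENNReal.ofReal_mul (norm_nonneg f), ← ofReal_norm]
    exact ENNReal.ofReal_le_ofReal (BSpace.norm_apply_le f x)
  | succ n ih =>
    have h1 : iterWeight P V (n + 1) x = ∫⁻ y, iterWeight P V n y ∂(P x) := by
      rw [iterWeight, Function.iterate_succ_apply']
      rfl
    rw [pow_succ', h1, ← lintegral_const_mul' _ _ ENNReal.ofReal_ne_top]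
    exact (enorm_integral_le_lintegral_enorm _).trans (lintegral_mono fun y => ih y)

theorem DriftIneq.norm_kernelOp_pow_apply_le {N : ℕ} {d δ : ℝ} (hdr : DriftIneq P V N d δ)
    (hδ : 0 ≤ δ) (hd : 0 ≤ d) (h : ActsOn P V) (f : BSpace V) (x : X) :
    ‖(kernelOp P V h ^ N) f x‖ ≤ ‖f‖ * (δ ^ N * V x + d) := by
  have hV := (V.pos x).le
  have h1 := (enorm_kernelOp_pow_apply_le h N f x).trans (mul_le_mul_right (hdr x) _)
  rw [← ENNReal.ofReal_mul (norm_nonneg f), ← ofReal_norm] at h1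
  exact (ENNReal.ofReal_le_ofReal_iff (by positivity)).1 h1

theorem DriftIneq.mono {N : ℕ} {d δ δ' : ℝ} (hdr : DriftIneq P V N d δ) (hδ : 0 ≤ δ)
    (hle : δ ≤ δ') : DriftIneq P V N d δ' := fun x =>
  (hdr x).trans (ENNReal.ofReal_le_ofReal (by
    have := mul_le_mul_of_nonneg_right (pow_le_pow_left₀ hδ hle N) (V.pos x).le
    linarith))

/-- An operator `T` with `|T f| ≤ ‖f‖ (a V + d)` is the sum of an operator of norm at most `a` and
of one that factors through `B_0`: multiply `T f` by `a V / (a V + d)` and by `d / (a V + d)`. -/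
theorem exists_norm_sub_incl_comp_le {T : BSpace V →L[ℂ] BSpace V} {a d : ℝ} (ha : 0 ≤ a)
    (hd : 0 < d) (hT : ∀ f x, ‖T f x‖ ≤ ‖f‖ * (a * V x + d)) :
    ∃ D : BSpace V →L[ℂ] BoundedMeas X, ‖D‖ ≤ d ∧ ‖T - BSpace.incl V ∘L D‖ ≤ a := by
  have hpos : ∀ x, 0 < a * V x + d := fun x =>
    add_pos_of_nonneg_of_pos (mul_nonneg ha (V.pos x).le) hd
  have hmeas : Measurable fun x => ((d / (a * V x + d) : ℝ) : ℂ) :=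
    Complex.measurable_ofReal.comp
      (measurable_const.div ((V.measurable'.const_mul a).add_const d))
  have hbd : ∀ f x, ‖((d / (a * V x + d) : ℝ) : ℂ) * T f x‖ ≤ d * ‖f‖ := fun f x => by
    rw [norm_mul, Complex.norm_real, Real.norm_of_nonneg (div_pos hd (hpos x)).le]
    calc d / (a * V x + d) * ‖T f x‖ ≤ d / (a * V x + d) * (‖f‖ * (a * V x + d)) :=
          mul_le_mul_of_nonneg_left (hT f x) (div_pos hd (hpos x)).le
      _ = d * ‖f‖ := by field_simp [(hpos x).ne']
  have hbd' : ∀ f x, ‖((d / (a * V x + d) : ℝ) : ℂ) * T f x‖ ≤ d * ‖f‖ * Weight.const X x :=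
    fun f x => (hbd f x).trans_eq (mul_one _).symm
  let D : BSpace V →ₗ[ℂ] BoundedMeas X :=
    { toFun := fun f => ⟨fun x => ((d / (a * V x + d) : ℝ) : ℂ) * T f x,
        hmeas.mul (T f).measurable, d * ‖f‖, hbd' f⟩
      map_add' := fun f g => BSpace.ext fun x => by
        have h1 : T (f + g) x = T f x + T g x := by rw [map_add]; rfl
        change _ * T (f + g) x = _ * T f x + _ * T g x
        rw [h1, mul_add]
      map_smul' := fun c f => BSpace.ext fun x => by
        have h1 : T (c • f) x = c * T f x := by rw [map_smul]; rfl
        change _ * T (c • f) x = c * (_ * T f x)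
        rw [h1, mul_left_comm] }
  have hD : ∀ f, ‖D f‖ ≤ d * ‖f‖ := fun f =>
    BSpace.norm_le_of_forall _ (mul_nonneg hd.le (norm_nonneg f)) (hbd' f)
  refine ⟨D.mkContinuous d hD, D.mkContinuous_norm_le hd.le hD,
    ContinuousLinearMap.opNorm_le_bound _ ha fun f =>
      BSpace.norm_le_of_forall _ (mul_nonneg ha (norm_nonneg f)) fun x => ?_⟩
  have h1 : (T - BSpace.incl V ∘L D.mkContinuous d hD) f x =
      ((a * V x / (a * V x + d) : ℝ) : ℂ) * T f x := by
    change T f x - ((d / (a * V x + d) : ℝ) : ℂ) * T f x = _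
    have h2 : a * V x / (a * V x + d) = 1 - d / (a * V x + d) := by
      field_simp [(hpos x).ne']
      ring
    rw [h2]
    push_cast
    ring
  have h3 : 0 ≤ a * V x / (a * V x + d) :=
    div_nonneg (mul_nonneg ha (V.pos x).le) (hpos x).le
  rw [h1, norm_mul, Complex.norm_real, Real.norm_of_nonneg h3]
  calc a * V x / (a * V x + d) * ‖T f x‖ ≤ a * V x / (a * V x + d) * (‖f‖ * (a * V x + d)) :=
        mul_le_mul_of_nonneg_left (hT f x) h3
    _ = a * ‖f‖ * V x := by field_simp [(hpos x).ne']

theorem actsOn_const (P : Kernel X X) [IsMarkovKernel P] : ActsOn P (Weight.const X) :=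
  ⟨1, fun x => by simp [Weight.const]⟩

theorem norm_kernelOp_const_le [IsMarkovKernel P] :
    ‖kernelOp P (Weight.const X) (actsOn_const P)‖ ≤ 1 := by
  refine ContinuousLinearMap.opNorm_le_bound _ zero_le_one fun f => ?_
  rw [one_mul]
  refine BSpace.norm_le_of_forall _ (norm_nonneg f) fun x => ?_
  have h := norm_integral_le_of_norm_le_const (μ := P x) (f := fun y => f y) (C := ‖f‖)
    (Eventually.of_forall fun y => by
      simpa [Weight.const] using BSpace.norm_apply_le f y)
  rwa [probReal_univ] at h

theorem norm_kernelOp_const_pow_apply_le [IsMarkovKernel P] (n : ℕ) (f : BoundedMeas X) :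
    ‖(kernelOp P (Weight.const X) (actsOn_const P) ^ n) f‖ ≤ ‖f‖ := by
  induction n with
  | zero => simp
  | succ n ih =>
    rw [pow_succ', mul_apply_eq_comp]
    exact ((ContinuousLinearMap.le_opNorm _ _).trans
      (mul_le_of_le_one_left (norm_nonneg _) norm_kernelOp_const_le)).trans ih

theorem kernelOp_pow_incl [IsMarkovKernel P] (h : ActsOn P V) (n : ℕ) (f : BoundedMeas X) :
    (kernelOp P V h ^ n) (BSpace.incl V f) =
      BSpace.incl V ((kernelOp P (Weight.const X) (actsOn_const P) ^ n) f) := by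
  induction n with
  | zero => rfl
  | succ n ih =>
    rw [pow_succ', pow_succ', mul_apply_eq_comp, mul_apply_eq_comp, ih]
    rfl

/-- Under `P^N V ≤ δ^N V + d`, each power of `P^N` is the sum of an operator of norm at most
`δ^(N k)` and of an operator that factors through `B_0`, with uniformly bounded factors. The bounds
on the second part do not degrade with `k` because `P` is a contraction of `B_0`. -/
theorem DriftIneq.exists_pow_eq_add [IsMarkovKernel P] {N : ℕ} {d δ : ℝ}
    (hdr : DriftIneq P V N d δ) (hδ : 0 ≤ δ) (hd : 0 < d) (h : ActsOn P V) (k : ℕ) :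
    ∃ (A : BSpace V →L[ℂ] BSpace V) (G : BSpace V →L[ℂ] BoundedMeas X),
      (kernelOp P V h ^ N) ^ k = A + BSpace.incl V ∘L G ∧ ‖A‖ ≤ (δ ^ N) ^ k ∧
        ‖G‖ ≤ d * ∑ j ∈ Finset.range k, (δ ^ N) ^ j := by
  have ha : 0 ≤ δ ^ N := pow_nonneg hδ N
  obtain ⟨D, hD, hTD⟩ := exists_norm_sub_incl_comp_le (T := kernelOp P V h ^ N) ha hd
    (hdr.norm_kernelOp_pow_apply_le hδ hd.le h)
  induction k with
  | zero =>
    refine ⟨1, 0, by simp, ?_, by simp⟩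
    rw [pow_zero]
    exact ContinuousLinearMap.norm_id_le
  | succ k ih =>
    obtain ⟨A, G, hAG, hA, hG⟩ := ih
    set T := kernelOp P V h ^ N with hT
    set T₀ := kernelOp P (Weight.const X) (actsOn_const P) ^ N
    refine ⟨(T - BSpace.incl V ∘L D) * A, T₀ ∘L G + D ∘L A, ?_, ?_, ?_⟩
    · refine ContinuousLinearMap.ext fun f => ?_
      have h1 : (T ^ k) f = A f + BSpace.incl V (G f) := by rw [hAG]; rfl
      have h2 : T (BSpace.incl V (G f)) = BSpace.incl V (T₀ (G f)) := kernelOp_pow_incl h N (G f)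
      rw [pow_succ', mul_apply_eq_comp, h1, map_add, h2]
      change _ = (T (A f) - BSpace.incl V (D (A f))) + BSpace.incl V (T₀ (G f) + D (A f))
      rw [map_add]
      abel
    · rw [pow_succ']
      exact (norm_mul_le _ _).trans (mul_le_mul hTD hA (norm_nonneg _) ha)
    · have h1 : ‖T₀ ∘L G‖ ≤ ‖G‖ := ContinuousLinearMap.opNorm_le_bound _ (norm_nonneg _) fun f =>
        (norm_kernelOp_const_pow_apply_le N (G f)).trans (G.le_opNorm f)
      have h2 : ‖D ∘L A‖ ≤ d * (δ ^ N) ^ k :=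
        (D.opNorm_comp_le A).trans (mul_le_mul hD hA (norm_nonneg _) hd.le)
      rw [Finset.sum_range_succ, mul_add]
      exact (norm_add_le _ _).trans (add_le_add (h1.trans hG) h2)

theorem DriftIneq.powerBounded [IsMarkovKernel P] {N : ℕ} {d δ : ℝ} (hdr : DriftIneq P V N d δ)
    (hN : 1 ≤ N) (hδ : 0 ≤ δ) (hδ1 : δ < 1) (hd : 0 < d) (h : ActsOn P V) :
    PowerBounded (kernelOp P V h) := by
  set L := kernelOp P V h with hL
  have ha : 0 ≤ δ ^ N := pow_nonneg hδ N
  have ha1 : δ ^ N < 1 := pow_lt_one₀ hδ hδ1 (by lia)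
  have hT : ∀ k, ‖(L ^ N) ^ k‖ ≤ 1 + ‖BSpace.incl V‖ * (d * (1 - δ ^ N)⁻¹) := fun k => by
    obtain ⟨A, G, hAG, hA, hG⟩ := hdr.exists_pow_eq_add hδ hd h k
    have hsum : ∑ j ∈ Finset.range k, (δ ^ N) ^ j ≤ (1 - δ ^ N)⁻¹ := by
      rw [← tsum_geometric_of_lt_one ha ha1]
      exact (summable_geometric_of_lt_one ha ha1).sum_le_tsum _ fun j _ => pow_nonneg ha j
    rw [hAG]
    refine (norm_add_le _ _).trans (add_le_add (hA.trans (pow_le_one₀ ha ha1.le)) ?_)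
    exact ((BSpace.incl V).opNorm_comp_le G).trans (mul_le_mul_of_nonneg_left
      (hG.trans (mul_le_mul_of_nonneg_left hsum hd.le)) (norm_nonneg _))
  refine ⟨(∑ i ∈ Finset.range N, ‖L ^ i‖) * (1 + ‖BSpace.incl V‖ * (d * (1 - δ ^ N)⁻¹)),
    fun n => ?_⟩
  have hn : L ^ n = L ^ (n % N) * (L ^ N) ^ (n / N) := by
    rw [← pow_mul, ← pow_add, Nat.mod_add_div]
  rw [hn]
  refine (norm_mul_le _ _).trans (mul_le_mul ?_ (hT _) (norm_nonneg _)
    (Finset.sum_nonneg fun i _ => norm_nonneg _))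
  exact Finset.single_le_sum (f := fun i => ‖L ^ i‖) (fun i _ => norm_nonneg _)
    (Finset.mem_range.2 (Nat.mod_lt n (by lia)))

/-- The compact operators close to the powers of `L` are `L ^ i L ^ ℓ G`, with `G` the part of
`(L ^ N) ^ k` that factors through `B_0`. -/
theorem DriftIneq.isNearCompact [IsMarkovKernel P] {N : ℕ} {d δ : ℝ} (hdr : DriftIneq P V N d δ)
    (hN : 1 ≤ N) (hδ : 0 < δ) (hδ1 : δ ≤ 1) (hd : 0 < d) (h : ActsOn P V) {ℓ : ℕ}
    (hcomp : IsCompactOperator ((kernelOp P V h ^ ℓ) ∘L BSpace.incl V)) :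
    IsNearCompact (kernelOp P V h) δ := by
  set L := kernelOp P V h with hL
  set S := ∑ i ∈ Finset.range N, ‖L ^ i‖
  refine ⟨S * ‖L ^ ℓ‖ / δ ^ (N + ℓ), ?_⟩
  filter_upwards [eventually_ge_atTop ℓ] with n hn
  set i := (n - ℓ) % N
  set k := (n - ℓ) / N
  have hi : i < N := Nat.mod_lt _ (by lia)
  have hnk : n = i + ℓ + N * k := by
    have := Nat.mod_add_div (n - ℓ) N
    lia
  obtain ⟨A, G, hAG, hA, -⟩ := hdr.exists_pow_eq_add hδ.le hd h k
  refine ⟨(L ^ i) ∘L (((L ^ ℓ) ∘L BSpace.incl V) ∘L G), (hcomp.comp_clm G).clm_comp (L ^ i), ?_⟩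
  have h1 : L ^ n - (L ^ i) ∘L (((L ^ ℓ) ∘L BSpace.incl V) ∘L G) = L ^ i * (L ^ ℓ * A) := by
    have h2 : L ^ n = L ^ i * (L ^ ℓ * (A + BSpace.incl V ∘L G)) := by
      rw [← hAG, ← pow_mul, ← pow_add, ← pow_add, ← add_assoc, ← hnk]
    rw [h2, mul_add, mul_add]
    exact add_sub_cancel_right _ _
  have hiS : ‖L ^ i‖ ≤ S :=
    Finset.single_le_sum (f := fun i => ‖L ^ i‖) (fun i _ => norm_nonneg _) (Finset.mem_range.2 hi)
  have hS : 0 ≤ S := (norm_nonneg _).trans hiS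
  have hpow : (δ ^ N) ^ k * δ ^ (N + ℓ) ≤ δ ^ n := by
    rw [← pow_mul, ← pow_add]
    exact pow_le_pow_of_le_one hδ.le hδ1 (by lia)
  rw [h1]
  calc ‖L ^ i * (L ^ ℓ * A)‖ ≤ ‖L ^ i‖ * (‖L ^ ℓ‖ * ‖A‖) :=
        (norm_mul_le _ _).trans (mul_le_mul_of_nonneg_left (norm_mul_le _ _) (norm_nonneg _))
    _ ≤ S * (‖L ^ ℓ‖ * (δ ^ N) ^ k) :=
        mul_le_mul hiS (mul_le_mul_of_nonneg_left hA (norm_nonneg _)) (by positivity) hS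
    _ ≤ S * (‖L ^ ℓ‖ * (δ ^ n / δ ^ (N + ℓ))) := by
        refine mul_le_mul_of_nonneg_left (mul_le_mul_of_nonneg_left ?_ (norm_nonneg _)) hS
        rwa [le_div_iff₀ (pow_pos hδ _)]
    _ = S * ‖L ^ ℓ‖ / δ ^ (N + ℓ) * δ ^ n := by ring

theorem one_mem_spectrum_kernelOp [Nonempty X] [IsMarkovKernel P] (h : ActsOn P V) :
    (1 : ℂ) ∈ spectrum ℂ (kernelOp P V h) := by
  intro hu
  let u : BSpace V := ⟨fun _ => 1, measurable_const, 1, fun x => by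
    simpa using V.one_le' x⟩
  have hLu : kernelOp P V h u = u := BSpace.ext fun x => by
    change ∫ _, (1 : ℂ) ∂(P x) = 1
    simp
  have h0 : (algebraMap ℂ (BSpace V →L[ℂ] BSpace V) 1 - kernelOp P V h) u = 0 := by
    rw [map_one, sub_apply, one_apply_eq_self, hLu, sub_self]
  have hu0 : u = 0 := (ContinuousLinearMap.isUnit_iff_bijective.1 hu).1 (h0.trans (map_zero _).symm)
  obtain ⟨x⟩ := ‹Nonempty X›
  have : (1 : ℂ) = 0 := congrArg (fun f : BSpace V => f x) hu0
  exact one_ne_zero this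

theorem exists_isNearCompact_of_driftRadius_lt [IsMarkovKernel P] (h : ActsOn P V)
    (hWD : WeakDrift P V) {ℓ : ℕ}
    (hcomp : IsCompactOperator ((kernelOp P V h ^ ℓ) ∘L BSpace.incl V)) {r : ℝ}
    (hr : driftRadius P V < r) (hr1 : r ≤ 1) :
    ∃ ρ, 0 < ρ ∧ ρ < r ∧ IsNearCompact (kernelOp P V h) ρ := by
  obtain ⟨N₀, hN₀, d₀, hd₀, δ₀, hδ₀, hδ₀1, hdr₀⟩ := hWD
  obtain ⟨δ, ⟨hδ, -, N, hN, d, hd, hdr⟩, hδr⟩ :=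
    exists_lt_of_csInf_lt (by exact ⟨δ₀, hδ₀.le, hδ₀1, N₀, hN₀, d₀, hd₀, hdr₀⟩) hr
  have hr0 : 0 < r := hδ.trans_lt hδr
  -- `δ = 0` is admissible in the drift radius, so move to a positive rate below `r`.
  have hlt : max δ (r / 2) < r := max_lt hδr (half_lt_self hr0)
  have hpos : 0 < max δ (r / 2) := lt_max_of_lt_right (half_pos hr0)
  exact ⟨max δ (r / 2), hpos, hlt, (hdr.mono hδ (le_max_left _ _)).isNearCompact hN hpos
    (hlt.le.trans hr1) hd h hcomp⟩

theorem WeakDrift.driftRadius_lt_one (hWD : WeakDrift P V) : driftRadius P V < 1 := by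
  obtain ⟨N, hN, d, hd, δ, hδ, hδ1, hdr⟩ := hWD
  refine lt_of_le_of_lt (csInf_le ⟨0, ?_⟩ ⟨hδ.le, hδ1, N, hN, d, hd, hdr⟩) hδ1
  exact fun _ h => h.1

theorem mem_decompRadii_of_driftRadius_lt [Nonempty X] [IsMarkovKernel P] (h : ActsOn P V)
    (hWD : WeakDrift P V) {ℓ : ℕ}
    (hcomp : IsCompactOperator ((kernelOp P V h ^ ℓ) ∘L BSpace.incl V)) {r : ℝ}
    (hr : driftRadius P V < r) (hr1 : r < 1) : r ∈ decompRadii (kernelOp P V h) := by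
  obtain ⟨ρ, hρ, hρr, hL⟩ := exists_isNearCompact_of_driftRadius_lt h hWD hcomp hr hr1.le
  have h1 := one_mem_spectrum_kernelOp h
  refine ⟨hρ.trans hρr, ?_, hL.hasSpectralDecomp hρ.le hρr ⟨1, h1, by simpa using hr1.le⟩⟩
  calc ENNReal.ofReal r < 1 := by rwa [ENNReal.ofReal_lt_one]
    _ = (‖(1 : ℂ)‖₊ : ℝ≥0∞) := by simp
    _ ≤ spectralRadius ℂ (kernelOp P V h) :=
        le_iSup₂ (f := fun (k : ℂ) (_ : k ∈ spectrum ℂ (kernelOp P V h)) => (‖k‖₊ : ℝ≥0∞)) 1 h1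

end MarkovKernels


theorem theorem2p2 {X : Type*} [MeasurableSpace X] [Nonempty X]
    (P : Kernel X X) [IsMarkovKernel P] (V : Weight X) (hPV : ActsOn P V)
    (hWD : WeakDrift P V)
    (ℓ : ℕ) (hℓ : 1 ≤ ℓ)
    (hcomp : IsCompactOperator ((kernelOp P V hPV ^ ℓ) ∘L BSpace.incl V)) :
    PowerBounded (kernelOp P V hPV) ∧
    IsQuasiCompact (kernelOp P V hPV) ∧
    essSpectralRadius (kernelOp P V hPV) ≤ driftRadius P V ∧
    sInf (decompRadii (kernelOp P V hPV)) ≤ driftRadius P V := by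
  have hlt := hWD.driftRadius_lt_one
  refine ⟨?_, ?_, ?_, ?_⟩
  · obtain ⟨N, hN, d, hd, δ, hδ, hδ1, hdr⟩ := hWD
    exact hdr.powerBounded hN hδ.le hδ1 hd hPV
  · obtain ⟨r, hr, hr1⟩ := exists_between hlt
    exact ⟨r, mem_decompRadii_of_driftRadius_lt hPV hWD hcomp hr hr1⟩
  · refine le_of_forall_gt_imp_ge_of_dense fun r hr => ?_
    obtain ⟨ρ, hρ, hρr, hL⟩ := exists_isNearCompact_of_driftRadius_lt hPV hWD hcomp
      (lt_min hr hlt) (min_le_right r 1)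
    exact (hL.essSpectralRadius_le hρ).trans (hρr.le.trans (min_le_left r 1))
  · refine le_of_forall_gt_imp_ge_of_dense fun r hr => ?_
    obtain ⟨s, hs, hsr⟩ := exists_between (lt_min hr hlt)
    have hmem := mem_decompRadii_of_driftRadius_lt hPV hWD hcomp hs
      (hsr.trans_le (min_le_right _ _))
    exact (csInf_le ⟨0, fun _ h => h.1.le⟩ hmem).trans (hsr.le.trans (min_le_left r 1))
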